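/- Let $A$ be a left Noetherian ring and let $\operatorname{proj} A$ be the category of finitely generated projective left $A$-modules. A complex $C$ in $\operatorname{proj} A$ (with differentials $C_n \to C_{n-1}$) is called totally acyclic if the complexes of abelian groups $\operatorname{Hom}_A(P,C)$ and $\operatorname{Hom}_A(C,P)$ are acyclic for every $P \in \operatorname{proj} A$, and eventually acyclic if for every $P \in \operatorname{proj} A$ one has $H_n(\operatorname{Hom}_A(P,C)) = 0$ for $|n| \gg 0$. In the homotopy category of complexes in $\operatorname{proj} A$ consider the following full subcategories, where the definitions are up to isomorphism: $\mathbf{K}_{\mathrm{tac}}(\operatorname{proj} A)$, the totally acyclic complexes; $\mathbf{K}^{-,\mathrm{b}}(\operatorname{proj} A)$, the eventually acyclic complexes $C$ with $C_n = 0$ for $n \ll 0$; and $\mathbf{K}^{\mathrm{b}}(\operatorname{proj} A)$, the complexes $C$ with $C_n = 0$ for $|n| \gg 0$. Let $\mathbf{D}^{\mathrm{b}}_{\mathrm{st}}(A) = \mathbf{K}^{-,\mathrm{b}}(\operatorname{proj} A)/\mathbf{K}^{\mathrm{b}}(\operatorname{proj} A)$ be the Verdier quotient, and let $$\beta_{\operatorname{proj}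 A} \colon \mathbf{K}_{\mathrm{tac}}(\operatorname{proj} A) \to \mathbf{D}^{\mathrm{b}}_{\mathrm{st}}(A)$$ be the functor induced by brutal truncation at degree zero, sending a totally acyclic complex $C$ to the complex $\cdots \to C_2 \to C_1 \to C_0 \to 0 \to 0 \to \cdots$. If the functor $\beta_{\operatorname{proj} A}$ is dense (that is, every object of $\mathbf{D}^{\mathrm{b}}_{\mathrm{st}}(A)$ is isomorphic to an object in its image), then every finitely generated injective left $A$-module has finite projective dimension. -/

import Mathlib

universe v u

noncomputable section

open CategoryTheory Limits Pretriangulated ZeroObject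

namespace StableDerived

/-! Complexes are indexed cohomologically: the term of homological degree `n` of a complex `C`
is `C.X (-n)`, so that Mathlib's triangulated structure on the homotopy category
`HomotopyCategory 𝓟 (ComplexShape.up ℤ)` can be used. -/

section HomComplexes

variable {𝓟 : Type u} [Category.{v} 𝓟] [Preadditive 𝓟]

/-- The complex of abelian groups `Hom(P, C)`. -/
def homTo (P : 𝓟) (C : CochainComplex 𝓟 ℤ) : CochainComplex AddCommGrpCat.{v} ℤ :=
  ((preadditiveCoyoneda.obj (Opposite.op P)).mapHomologicalComplex (ComplexShape.up ℤ)).obj C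

/-- The complex of abelian groups `Hom(C, P)`; its term in position `n` is `Hom(C.X n, P)`,
and its differentials go in the direction opposite to those of `C`. -/
def homFrom (C : CochainComplex 𝓟 ℤ) (P : 𝓟) :
    HomologicalComplex AddCommGrpCat.{v} (ComplexShape.up ℤ).symm :=
  ((preadditiveYoneda.obj P).mapHomologicalComplex (ComplexShape.up ℤ).symm).obj
    (HomologicalComplex.op C)

/-- A complex `C` is acyclic if `Hom(P, C)` is acyclic for all objects `P`. -/
def IsAcyclic (C : CochainComplex 𝓟 ℤ) : Prop :=
  ∀ P : 𝓟, (homTo P C).Acyclic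

/-- A complex `C` is totally acyclic if it is acyclic and `Hom(C, P)` is acyclic for all `P`. -/
def IsTotallyAcyclic (C : CochainComplex 𝓟 ℤ) : Prop :=
  IsAcyclic C ∧ ∀ P : 𝓟, (homFrom C P).Acyclic

/-- A complex `C` is eventually acyclic if for all objects `P`, the homology of `Hom(P, C)`
vanishes in all degrees of large absolute value. -/
def IsEventuallyAcyclic (C : CochainComplex 𝓟 ℤ) : Prop :=
  ∀ P : 𝓟, ∃ N : ℕ, ∀ n : ℤ, (N : ℤ) < |n| → (homTo P C).ExactAt n

lemma homTo_exactAt_iff (P : 𝓟) (C : CochainComplex 𝓟 ℤ) (i j k : ℤ) (hij : i + 1 = j)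
    (hjk : j + 1 = k) : (homTo P C).ExactAt j ↔
      ∀ f : P ⟶ C.X j, f ≫ C.d j k = 0 → ∃ g : P ⟶ C.X i, g ≫ C.d i j = f := by
  rw [HomologicalComplex.exactAt_iff' _ i j k (by simp; omega) (by simp; omega),
    ShortComplex.ab_exact_iff]
  rfl

end HomComplexes

section Subcategories

variable (𝓟 : Type u) [Category.{v} 𝓟] [Preadditive 𝓟]

/-- The homotopy category of complexes in `𝓟`. -/
abbrev K := HomotopyCategory 𝓟 (ComplexShape.up ℤ)

/-- The totally acyclic complexes. (As `Hom(P, -)` and `Hom(-, P)` preserve homotopy equivalences,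
this property is invariant under isomorphisms in the homotopy category.) -/
def totallyAcyclic : ObjectProperty (K 𝓟) := fun X ↦ IsTotallyAcyclic X.as

/-- The eventually acyclic complexes. -/
def eventuallyAcyclic : ObjectProperty (K 𝓟) := fun X ↦ IsEventuallyAcyclic X.as

/-- The complexes that vanish in all sufficiently large cohomological degrees, i.e.
`Cₙ = 0` for `n ≪ 0` in homological notation. -/
def rightBounded : ObjectProperty (K 𝓟) :=
  fun X ↦ ∃ n : ℤ, CochainComplex.IsStrictlyLE X.as n

/-- The complexes with only finitely many nonzero terms. -/
def bounded : ObjectProperty (K 𝓟) :=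
  fun X ↦ ∃ m n : ℤ, CochainComplex.IsStrictlyGE X.as m ∧ CochainComplex.IsStrictlyLE X.as n

/-- The objects of `K^{-,b}(𝓟)`: up to isomorphism in the homotopy category, the right bounded
eventually acyclic complexes. -/
def Kminusb : ObjectProperty (K 𝓟) := (rightBounded 𝓟 ⊓ eventuallyAcyclic 𝓟).isoClosure

/-- The objects of `K^b(𝓟)`: up to isomorphism in the homotopy category, the bounded complexes. -/
def Kb : ObjectProperty (K 𝓟) := (bounded 𝓟).isoClosure

instance : (Kminusb 𝓟).IsClosedUnderIsomorphisms := by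
  unfold Kminusb; infer_instance

instance : (Kb 𝓟).IsClosedUnderIsomorphisms := by
  unfold Kb; infer_instance

/-- `Hom(P, -)` on homotopy categories, followed by homology in degree `n`. -/
def homToHomology (P : 𝓟) (n : ℤ) : K 𝓟 ⥤ AddCommGrpCat.{v} :=
  (preadditiveCoyoneda.obj (Opposite.op P)).mapHomotopyCategory (ComplexShape.up ℤ) ⋙
    HomotopyCategory.homologyFunctor AddCommGrpCat.{v} (ComplexShape.up ℤ) n

lemma isZero_homToHomology_iff (P : 𝓟) (n : ℤ) (X : K 𝓟) :
    IsZero ((homToHomology 𝓟 P n).obj X) ↔ (homTo P X.as).ExactAt n := by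
  rw [HomologicalComplex.exactAt_iff_isZero_homology]
  exact ((HomotopyCategory.homologyFunctorFactors AddCommGrpCat.{v} (ComplexShape.up ℤ) n).app
    (homTo P X.as)).isZero_iff

lemma eventuallyAcyclic_iff (X : K 𝓟) : eventuallyAcyclic 𝓟 X ↔
    ∀ P : 𝓟, ∃ N : ℕ, ∀ n : ℤ, (N : ℤ) < |n| → IsZero ((homToHomology 𝓟 P n).obj X) := by
  simp only [isZero_homToHomology_iff]
  rfl

instance : (eventuallyAcyclic 𝓟).IsClosedUnderIsomorphisms where
  of_iso e h := by
    rw [eventuallyAcyclic_iff] at h ⊢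
    intro P
    obtain ⟨N, hN⟩ := h P
    exact ⟨N, fun n hn ↦ (hN n hn).of_iso ((homToHomology 𝓟 P n).mapIso e.symm)⟩

variable [HasZeroObject 𝓟] [HasBinaryBiproducts 𝓟]

instance (P : 𝓟) (n : ℤ) : (homToHomology 𝓟 P n).IsHomological := by
  unfold homToHomology; infer_instance

instance : (eventuallyAcyclic 𝓟).IsTriangulated where
  exists_zero := ⟨0, isZero_zero _, by
    rw [eventuallyAcyclic_iff]
    exact fun P ↦ ⟨0, fun n _ ↦ (homToHomology 𝓟 P n).map_isZero (isZero_zero _)⟩⟩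
  isStableUnderShiftBy a := ⟨fun X h ↦ by
    obtain ⟨X : CochainComplex _ _, rfl⟩ := X.quotient_obj_surjective
    rw [ObjectProperty.prop_shift_iff, HomotopyCategory.shift_quotient_obj]
    intro P
    obtain ⟨N, hN⟩ := h P
    refine ⟨N + a.natAbs, fun n hn ↦ ?_⟩
    have := hN (n + a) (by
      rw [Nat.cast_add, Int.natCast_natAbs] at hn
      have := abs_sub_abs_le_abs_sub n (-a)
      rw [abs_neg, sub_neg_eq_add] at this
      omega)
    change (homTo P X).ExactAt (n + a) at this
    change (homTo P (X⟦a⟧)).ExactAt n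
    rw [homTo_exactAt_iff P X (n - 1 + a) (n + a) (n + 1 + a) (by ring) (by ring)] at this
    rw [homTo_exactAt_iff P _ (n - 1) n (n + 1) (by ring) (by ring)]
    change ∀ f : P ⟶ X.X (n + a), f ≫ (a.negOnePow • X.d (n + a) (n + 1 + a)) = 0 →
      ∃ g : P ⟶ X.X (n - 1 + a), g ≫ (a.negOnePow • X.d (n - 1 + a) (n + a)) = f
    intro f hf
    obtain ⟨g, hg⟩ := this f (by
      rw [Linear.comp_units_smul] at hf
      exact (smul_eq_zero_iff_eq _).1 hf)
    refine ⟨a.negOnePow • g, ?_⟩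
    rw [Linear.comp_units_smul, Linear.units_smul_comp, smul_smul, Int.units_mul_self, one_smul,
      hg]⟩
  toIsTriangulatedClosed₂ := .mk' (fun T hT h₁ h₃ ↦ by
    rw [eventuallyAcyclic_iff] at h₁ h₃ ⊢
    intro P
    obtain ⟨N₁, hN₁⟩ := h₁ P
    obtain ⟨N₃, hN₃⟩ := h₃ P
    exact ⟨max N₁ N₃, fun n hn ↦
      ((homToHomology 𝓟 P n).map_distinguished_exact T hT).isZero_of_both_zeros
        ((hN₁ n (by push_cast at hn; omega)).eq_of_src _ _)
        ((hN₃ n (by push_cast at hn; omega)).eq_of_tgt _ _)⟩)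

lemma exists_iso_mappingCone (T : Triangle (K 𝓟)) (hT : T ∈ distTriang (K 𝓟)) :
    ∃ f : T.obj₁.as ⟶ T.obj₂.as,
      Nonempty (T.obj₃ ≅ (HomotopyCategory.quotient _ _).obj (CochainComplex.mappingCone f)) := by
  obtain ⟨f : T.obj₁.as ⟶ T.obj₂.as, hf⟩ :=
    (HomotopyCategory.quotient 𝓟 (ComplexShape.up ℤ)).map_surjective T.mor₁
  refine ⟨f, ⟨Triangle.π₃.mapIso (isoTriangleOfIso₁₂ T _ hT
    (HomotopyCategory.mappingCone_triangleh_distinguished f) (Iso.refl _) (Iso.refl _) ?_)⟩⟩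
  exact (Category.comp_id _).trans (hf.symm.trans (Category.id_comp _).symm)

instance : (rightBounded 𝓟).IsTriangulatedClosed₃ where
  ext₃' T hT h₁ h₂ := by
    obtain ⟨f, ⟨e⟩⟩ := exists_iso_mappingCone 𝓟 T hT
    obtain ⟨a, ha⟩ := h₁
    obtain ⟨b, hb⟩ := h₂
    refine ⟨_, ⟨max a b, ?_⟩, ⟨e⟩⟩
    change CochainComplex.IsStrictlyLE (CochainComplex.mappingCone f) _
    rw [CochainComplex.isStrictlyLE_iff] at ha hb ⊢
    intro i hi
    rw [CochainComplex.mappingCone.isZero_X_iff]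
    exact ⟨ha _ (by omega), hb _ (by omega)⟩

instance : (rightBounded 𝓟).IsStableUnderShift ℤ where
  isStableUnderShiftBy a := ⟨fun X h ↦ by
    obtain ⟨X : CochainComplex _ _, rfl⟩ := X.quotient_obj_surjective
    obtain ⟨q, hq⟩ := h
    rw [ObjectProperty.prop_shift_iff, HomotopyCategory.shift_quotient_obj]
    have : X.IsStrictlyLE q := hq
    exact ⟨q - a, CochainComplex.isStrictlyLE_shift X q a (q - a) (by omega)⟩⟩

instance : (rightBounded 𝓟).IsTriangulated where
  exists_zero := ⟨(HomotopyCategory.quotient _ _).obj 0,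
    Functor.map_isZero _ (isZero_zero _), 0,
    (CochainComplex.isStrictlyLE_iff _ _).2 fun i _ ↦
      (HomologicalComplex.eval 𝓟 (ComplexShape.up ℤ) i).map_isZero (isZero_zero _)⟩
  toIsTriangulatedClosed₂ := .of_isTriangulatedClosed₃

instance : (bounded 𝓟).IsTriangulatedClosed₃ where
  ext₃' T hT h₁ h₂ := by
    obtain ⟨f, ⟨e⟩⟩ := exists_iso_mappingCone 𝓟 T hT
    obtain ⟨a, a', ha, ha'⟩ := h₁
    obtain ⟨b, b', hb, hb'⟩ := h₂
    refine ⟨_, ⟨min (a - 1) b, max a' b', ?_, ?_⟩, ⟨e⟩⟩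
    · change CochainComplex.IsStrictlyGE (CochainComplex.mappingCone f) _
      rw [CochainComplex.isStrictlyGE_iff] at ha hb ⊢
      intro i hi
      rw [CochainComplex.mappingCone.isZero_X_iff]
      exact ⟨ha _ (by omega), hb _ (by omega)⟩
    · change CochainComplex.IsStrictlyLE (CochainComplex.mappingCone f) _
      rw [CochainComplex.isStrictlyLE_iff] at ha' hb' ⊢
      intro i hi
      rw [CochainComplex.mappingCone.isZero_X_iff]
      exact ⟨ha' _ (by omega), hb' _ (by omega)⟩

instance : (bounded 𝓟).IsStableUnderShift ℤ where
  isStableUnderShiftBy a := ⟨fun X h ↦ by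
    obtain ⟨X : CochainComplex _ _, rfl⟩ := X.quotient_obj_surjective
    obtain ⟨p, q, hp, hq⟩ := h
    rw [ObjectProperty.prop_shift_iff, HomotopyCategory.shift_quotient_obj]
    have : X.IsStrictlyGE p := hp
    have : X.IsStrictlyLE q := hq
    exact ⟨p - a, q - a, CochainComplex.isStrictlyGE_shift X p a (p - a) (by omega),
      CochainComplex.isStrictlyLE_shift X q a (q - a) (by omega)⟩⟩

instance : (bounded 𝓟).IsTriangulated where
  exists_zero := ⟨(HomotopyCategory.quotient _ _).obj 0,
    Functor.map_isZero _ (isZero_zero _), 0, 0,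
    (CochainComplex.isStrictlyGE_iff _ _).2 fun i _ ↦
      (HomologicalComplex.eval 𝓟 (ComplexShape.up ℤ) i).map_isZero (isZero_zero _),
    (CochainComplex.isStrictlyLE_iff _ _).2 fun i _ ↦
      (HomologicalComplex.eval 𝓟 (ComplexShape.up ℤ) i).map_isZero (isZero_zero _)⟩
  toIsTriangulatedClosed₂ := .of_isTriangulatedClosed₃

instance : (Kminusb 𝓟).IsTriangulated := by
  unfold Kminusb; infer_instance

instance : (Kb 𝓟).IsTriangulated := by
  unfold Kb; infer_instance

/-- The homotopy category of totally acyclic complexes. -/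
abbrev Ktac := (totallyAcyclic 𝓟).FullSubcategory

/-- The triangulated category `K^{-,b}(𝓟)`. -/
abbrev KminusbCat := (Kminusb 𝓟).FullSubcategory

/-- `K^b(𝓟)` as a triangulated subcategory of `K^{-,b}(𝓟)`. -/
def KbInKminusb : ObjectProperty (KminusbCat 𝓟) := (Kb 𝓟).inverseImage (Kminusb 𝓟).ι

instance : (KbInKminusb 𝓟).IsTriangulated := by
  unfold KbInKminusb; infer_instance

instance : (KbInKminusb 𝓟).IsClosedUnderIsomorphisms := by
  unfold KbInKminusb; infer_instance

/-- The Verdier quotient `K^{-,b}(𝓟) / K^b(𝓟)`: the localization of `K^{-,b}(𝓟)` at the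
morphisms whose mapping cone belongs to `K^b(𝓟)`. -/
abbrev Dst := (KbInKminusb 𝓟).trW.Localization

/-- The quotient functor `K^{-,b}(𝓟) ⥤ K^{-,b}(𝓟) / K^b(𝓟)`. -/
abbrev Dst.Q : KminusbCat 𝓟 ⥤ Dst 𝓟 := (KbInKminusb 𝓟).trW.Q

end Subcategories

section BrutalTruncation

variable {𝓟 : Type u} [Category.{v} 𝓟] [Preadditive 𝓟] [HasZeroObject 𝓟]

/-- The brutal truncation of a complex at degree zero: it keeps the terms of homological
degree `≥ 0`, i.e. of cohomological degree `≤ 0`, and replaces the others by zero. -/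
abbrev brutalTrunc (C : CochainComplex 𝓟 ℤ) : CochainComplex 𝓟 ℤ :=
  C.stupidTrunc (ComplexShape.embeddingUpIntLE 0)

/-- The chain map between brutal truncations induced by a chain map. -/
abbrev brutalTruncMap {C D : CochainComplex 𝓟 ℤ} (φ : C ⟶ D) : brutalTrunc C ⟶ brutalTrunc D :=
  HomologicalComplex.stupidTruncMap φ (ComplexShape.embeddingUpIntLE 0)

lemma brutalTrunc_d (C : CochainComplex 𝓟 ℤ) {i j : ℕ} {i' j' : ℤ}
    (hi : (ComplexShape.embeddingUpIntLE 0).f i = i')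
    (hj : (ComplexShape.embeddingUpIntLE 0).f j = j') :
    (brutalTrunc C).d i' j' =
      (C.stupidTruncXIso (ComplexShape.embeddingUpIntLE 0) hi).hom ≫ C.d i' j' ≫
        (C.stupidTruncXIso (ComplexShape.embeddingUpIntLE 0) hj).inv := by
  subst hi hj
  have e₁ : ∀ {k : ℕ}, C.stupidTruncXIso (ComplexShape.embeddingUpIntLE 0) (i := k) rfl =
      (C.restriction (ComplexShape.embeddingUpIntLE 0)).extendXIso
        (ComplexShape.embeddingUpIntLE 0) rfl := by
    intro k
    ext
    exact Category.comp_id _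
  rw [e₁, e₁]
  exact (C.restriction (ComplexShape.embeddingUpIntLE 0)).extend_d_eq
    (ComplexShape.embeddingUpIntLE 0) rfl rfl

lemma isEventuallyAcyclic_brutalTrunc (C : CochainComplex 𝓟 ℤ) (hC : IsAcyclic C) :
    IsEventuallyAcyclic (brutalTrunc C) := by
  intro P
  refine ⟨0, fun n hn ↦ ?_⟩
  rw [homTo_exactAt_iff P _ (n - 1) n (n + 1) (by ring) (by ring)]
  intro f hf
  by_cases h : 0 < n
  · exact ⟨0, (CochainComplex.isZero_of_isStrictlyLE (brutalTrunc C) 0 n h).eq_of_tgt _ _⟩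
  · obtain ⟨k, rfl⟩ : ∃ k : ℕ, n = -(k + 1 : ℤ) :=
      ⟨(-n - 1).toNat, by push_cast at hn; rcases abs_cases n with h | h <;> omega⟩
    have h₀ : (ComplexShape.embeddingUpIntLE 0).f (k + 2) = -(k + 1 : ℤ) - 1 := by
      simp; ring
    have h₁ : (ComplexShape.embeddingUpIntLE 0).f (k + 1) = -(k + 1 : ℤ) := by simp
    have h₂ : (ComplexShape.embeddingUpIntLE 0).f k = -(k + 1 : ℤ) + 1 := by simp
    have ex := (homTo_exactAt_iff P C (-(k + 1 : ℤ) - 1) (-(k + 1 : ℤ)) (-(k + 1 : ℤ) + 1)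
      (by ring) (by ring)).1 (hC P _)
    rw [brutalTrunc_d C h₁ h₂] at hf
    obtain ⟨g, hg⟩ := ex (f ≫ (C.stupidTruncXIso _ h₁).hom) (by
      rw [← cancel_mono (C.stupidTruncXIso _ h₂).inv]
      simpa using hf)
    refine ⟨g ≫ (C.stupidTruncXIso _ h₀).inv, ?_⟩
    rw [brutalTrunc_d C h₀ h₁, Category.assoc, Iso.inv_hom_id_assoc, reassoc_of% hg]
    simp

/-- The truncations of two homotopic chain maps differ, up to homotopy, by a map that factors
through a stalk complex. -/
lemma brutalTrunc_homotopy {C D : CochainComplex 𝓟 ℤ} {φ ψ : C ⟶ D} (h : Homotopy φ ψ) :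
    ∃ (Z : CochainComplex 𝓟 ℤ) (_ : Z.IsStrictlyGE 0) (_ : Z.IsStrictlyLE 0)
      (a : brutalTrunc C ⟶ Z) (b : Z ⟶ brutalTrunc D),
      Nonempty (Homotopy (brutalTruncMap φ) (brutalTruncMap ψ + a ≫ b)) := by
  let e := ComplexShape.embeddingUpIntLE 0
  let a₀ : C.restriction e ⟶ (ChainComplex.single₀ 𝓟).obj (C.X 1) :=
    (ChainComplex.toSingle₀Equiv _ _).symm ⟨C.d (e.f 0) 1, C.d_comp_d _ _ _⟩
  let b₀ : (ChainComplex.single₀ 𝓟).obj (C.X 1) ⟶ D.restriction e :=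
    (ChainComplex.fromSingle₀Equiv _ _).symm (h.hom 1 (e.f 0))
  have hb : ∀ i, b₀.f (i + 1) = 0 := fun i ↦ rfl
  have ha₀ : a₀.f 0 = C.d (e.f 0) 1 := ChainComplex.toSingle₀Equiv_symm_apply_f_zero _ _
  have hb₀ : b₀.f 0 = h.hom 1 (e.f 0) := ChainComplex.fromSingle₀Equiv_symm_apply_f_zero _
  have hab : a₀.f 0 ≫ b₀.f 0 = C.d (e.f 0) 1 ≫ h.hom 1 (e.f 0) :=
    congrArg₂ (fun (x : C.X (e.f 0) ⟶ C.X 1) (y : C.X 1 ⟶ D.X (e.f 0)) ↦ x ≫ y) ha₀ hb₀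
  let η : ∀ i j, (C.restriction e).X i ⟶ (D.restriction e).X j := fun i j ↦ h.hom (e.f i) (e.f j)
  have H : Homotopy (HomologicalComplex.restrictionMap φ e)
      (HomologicalComplex.restrictionMap ψ e + a₀ ≫ b₀) :=
    { hom := η
      zero := fun i j hij ↦ h.zero _ _ (fun hij' ↦ hij ((e.rel_iff j i).1 hij'))
      comm := fun i ↦ by
        have := h.comm (e.f i)
        obtain _ | i := i
        · have r₁ : (ComplexShape.up ℤ).Rel (e.f 0) 1 := by simp [e]
          have r₂ : (ComplexShape.up ℤ).Rel (e.f 1) (e.f 0) := by simp [e]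
          rw [dNext_eq _ r₁, prevD_eq _ r₂] at this
          rw [Homotopy.dNext_zero_chainComplex, Homotopy.prevD_chainComplex]
          have eq : φ.f (e.f 0) = 0 + h.hom (e.f 0) (e.f 1) ≫ D.d (e.f 1) (e.f 0) +
              (ψ.f (e.f 0) + C.d (e.f 0) 1 ≫ h.hom 1 (e.f 0)) := by
            rw [this]
            abel
          exact eq.trans (congrArg (fun x : C.X (e.f 0) ⟶ D.X (e.f 0) ↦
            0 + h.hom (e.f 0) (e.f 1) ≫ D.d (e.f 1) (e.f 0) + (ψ.f (e.f 0) + x)) hab.symm)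
        · have r₁ : (ComplexShape.up ℤ).Rel (e.f (i + 1)) (e.f i) := by simp [e]
          have r₂ : (ComplexShape.up ℤ).Rel (e.f (i + 2)) (e.f (i + 1)) := by simp [e]; ring
          rw [dNext_eq _ r₁, prevD_eq _ r₂] at this
          rw [Homotopy.dNext_succ_chainComplex, Homotopy.prevD_chainComplex]
          have eq : φ.f (e.f (i + 1)) = C.d (e.f (i + 1)) (e.f i) ≫ h.hom (e.f i) (e.f (i + 1)) +
              h.hom (e.f (i + 1)) (e.f (i + 2)) ≫ D.d (e.f (i + 2)) (e.f (i + 1)) +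
              (ψ.f (e.f (i + 1)) + 0) := by
            rw [this, add_zero]
          have hab' : a₀.f (i + 1) ≫ b₀.f (i + 1) = 0 := by rw [hb, comp_zero]
          exact eq.trans (congrArg (fun x : C.X (e.f (i + 1)) ⟶ D.X (e.f (i + 1)) ↦
            C.d (e.f (i + 1)) (e.f i) ≫ h.hom (e.f i) (e.f (i + 1)) +
              h.hom (e.f (i + 1)) (e.f (i + 2)) ≫ D.d (e.f (i + 2)) (e.f (i + 1)) +
              (ψ.f (e.f (i + 1)) + x)) hab'.symm) }
  refine ⟨((ChainComplex.single₀ 𝓟).obj (C.X 1)).extend e, ?_, ?_,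
    HomologicalComplex.extendMap a₀ e, HomologicalComplex.extendMap b₀ e, ⟨?_⟩⟩
  · rw [CochainComplex.isStrictlyGE_iff]
    intro i hi
    obtain ⟨k, rfl⟩ : ∃ k : ℕ, i = -(k + 1 : ℤ) := ⟨(-i - 1).toNat, by omega⟩
    exact (HomologicalComplex.isZero_single_obj_X (ComplexShape.down ℕ) 0 (C.X 1) (k + 1)
      (by omega)).of_iso (HomologicalComplex.extendXIso _ e (i := k + 1) (by simp [e]))
  · infer_instance
  · refine (H.extend e).trans (Homotopy.ofEq ?_)
    rw [HomologicalComplex.extendMap_add, HomologicalComplex.extendMap_comp]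
    rfl

end BrutalTruncation

section Beta

variable {𝓟 : Type u} [Category.{v} 𝓟] [Preadditive 𝓟] [HasZeroObject 𝓟]

lemma kminusb_brutalTrunc (C : CochainComplex 𝓟 ℤ) (hC : IsAcyclic C) :
    Kminusb 𝓟 ((HomotopyCategory.quotient _ _).obj (brutalTrunc C)) :=
  ObjectProperty.le_isoClosure _ _
    ⟨⟨0, inferInstanceAs ((brutalTrunc C).IsStrictlyLE 0)⟩, isEventuallyAcyclic_brutalTrunc C hC⟩

/-- The brutal truncation of an acyclic complex, as an object of `K^{-,b}(𝓟)`. -/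
def truncObj (C : CochainComplex 𝓟 ℤ) (hC : IsAcyclic C) : KminusbCat 𝓟 :=
  ⟨(HomotopyCategory.quotient _ _).obj (brutalTrunc C), kminusb_brutalTrunc C hC⟩

/-- The morphism in `K^{-,b}(𝓟)` given by the brutal truncation of a chain map. -/
def truncMap {C D : CochainComplex 𝓟 ℤ} (hC : IsAcyclic C) (hD : IsAcyclic D) (φ : C ⟶ D) :
    truncObj C hC ⟶ truncObj D hD :=
  ObjectProperty.homMk ((HomotopyCategory.quotient _ _).map (brutalTruncMap φ))

lemma truncMap_id (C : CochainComplex 𝓟 ℤ) (hC : IsAcyclic C) :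
    truncMap hC hC (𝟙 C) = 𝟙 (truncObj C hC) := by
  apply ObjectProperty.hom_ext
  exact (congrArg (HomotopyCategory.quotient 𝓟 (ComplexShape.up ℤ)).map
    (HomologicalComplex.stupidTruncMap_id C _)).trans
    ((HomotopyCategory.quotient 𝓟 (ComplexShape.up ℤ)).map_id _)

lemma truncMap_comp {C D E : CochainComplex 𝓟 ℤ} (hC : IsAcyclic C) (hD : IsAcyclic D)
    (hE : IsAcyclic E) (φ : C ⟶ D) (ψ : D ⟶ E) :
    truncMap hC hE (φ ≫ ψ) = truncMap hC hD φ ≫ truncMap hD hE ψ := by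
  apply ObjectProperty.hom_ext
  exact (congrArg (HomotopyCategory.quotient 𝓟 (ComplexShape.up ℤ)).map
    (HomologicalComplex.stupidTruncMap_comp φ ψ _)).trans
    ((HomotopyCategory.quotient 𝓟 (ComplexShape.up ℤ)).map_comp _ _)

variable [HasBinaryBiproducts 𝓟]

/-- Morphisms of `K^{-,b}(𝓟)` which differ by a morphism factoring through an object of `K^b(𝓟)`
become equal in the Verdier quotient. -/
lemma Q_map_eq_of_factor {X Y Z : KminusbCat 𝓟} (f g : X ⟶ Y) (hZ : KbInKminusb 𝓟 Z)
    (a : X ⟶ Z) (b : Z ⟶ Y) (h : f = g + a ≫ b) : (Dst.Q 𝓟).map f = (Dst.Q 𝓟).map g := by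
  obtain ⟨W, s, t, hT⟩ := distinguished_cocone_triangle b
  have hs : (KbInKminusb 𝓟).trW s := ObjectProperty.trW.mk' _ hT hZ
  have hbs : b ≫ s = 0 := comp_distTriang_mor_zero₁₂ _ hT
  have : IsIso ((Dst.Q 𝓟).map s) := MorphismProperty.Q_inverts _ _ hs
  rw [← cancel_mono ((Dst.Q 𝓟).map s), ← Functor.map_comp, ← Functor.map_comp, h,
    Preadditive.add_comp, Category.assoc, hbs, comp_zero, add_zero]

lemma Q_map_truncMap_eq {C D : CochainComplex 𝓟 ℤ} (hC : IsAcyclic C) (hD : IsAcyclic D)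
    {φ ψ : C ⟶ D} (h : Homotopy φ ψ) :
    (Dst.Q 𝓟).map (truncMap hC hD φ) = (Dst.Q 𝓟).map (truncMap hC hD ψ) := by
  obtain ⟨Z, hZ, hZ', a, b, ⟨H⟩⟩ := brutalTrunc_homotopy h
  have hZb : bounded 𝓟 ((HomotopyCategory.quotient _ _).obj Z) := ⟨0, 0, hZ, hZ'⟩
  have hZe : IsEventuallyAcyclic Z := by
    intro P
    refine ⟨0, fun n hn ↦ ?_⟩
    rw [homTo_exactAt_iff P Z (n - 1) n (n + 1) (by ring) (by ring)]
    have hz : IsZero (Z.X n) := by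
      obtain h | h := lt_or_gt_of_ne (abs_pos.1 hn)
      · exact CochainComplex.isZero_of_isStrictlyGE Z 0 n h
      · exact CochainComplex.isZero_of_isStrictlyLE Z 0 n h
    exact fun f _ ↦ ⟨0, hz.eq_of_tgt _ _⟩
  let Z₀ : KminusbCat 𝓟 := ⟨(HomotopyCategory.quotient _ _).obj Z,
    ObjectProperty.le_isoClosure _ _ ⟨⟨0, hZ'⟩, hZe⟩⟩
  refine Q_map_eq_of_factor (Z := Z₀) _ _ (ObjectProperty.le_isoClosure _ _ hZb)
    (ObjectProperty.homMk ((HomotopyCategory.quotient _ _).map a))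
    (ObjectProperty.homMk ((HomotopyCategory.quotient _ _).map b)) ?_
  apply ObjectProperty.hom_ext
  exact (HomotopyCategory.eq_of_homotopy _ _ H).trans (by
    rw [Functor.map_add, Functor.map_comp]; rfl)

lemma Q_map_truncMap_eq_of_quotient_map_eq {C D : CochainComplex 𝓟 ℤ} (hC : IsAcyclic C)
    (hD : IsAcyclic D) {φ ψ : C ⟶ D} (h : (HomotopyCategory.quotient 𝓟 (ComplexShape.up ℤ)).map φ =
      (HomotopyCategory.quotient 𝓟 (ComplexShape.up ℤ)).map ψ) :
    (Dst.Q 𝓟).map (truncMap hC hD φ) = (Dst.Q 𝓟).map (truncMap hC hD ψ) :=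
  Q_map_truncMap_eq hC hD (HomotopyCategory.homotopyOfEq _ _ h)

variable (𝓟) in
/-- The functor `β_𝓟` from the homotopy category of totally acyclic complexes to the Verdier
quotient `K^{-,b}(𝓟) / K^b(𝓟)` that is induced by brutal truncation at degree zero: it sends a
complex `C` to its truncation, and the homotopy class of a chain map `φ` to the class of the
truncation of `φ`, which does not depend on the representative `φ` (see `beta_map_eq`). -/
def beta : Ktac 𝓟 ⥤ Dst 𝓟 where
  obj X := (Dst.Q 𝓟).obj (truncObj X.obj.as X.property.1)
  map {X Y} f := (Dst.Q 𝓟).map (truncMap X.property.1 Y.property.1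
    (Quot.out f.hom : X.obj.as ⟶ Y.obj.as))
  map_id X := by
    refine (Q_map_truncMap_eq_of_quotient_map_eq X.property.1 X.property.1 (ψ := 𝟙 X.obj.as)
      (Quot.out_eq _)).trans ?_
    rw [truncMap_id, CategoryTheory.Functor.map_id]
  map_comp {X Y Z} f g := by
    refine (Q_map_truncMap_eq_of_quotient_map_eq X.property.1 Z.property.1
      (ψ := (Quot.out f.hom : X.obj.as ⟶ Y.obj.as) ≫ (Quot.out g.hom : Y.obj.as ⟶ Z.obj.as))
      ((Quot.out_eq _).trans
        (HomotopyCategory.quotient_map_out_comp_out f.hom g.hom).symm)).trans ?_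
    rw [truncMap_comp _ Y.property.1, Functor.map_comp]

lemma beta_map_eq {X Y : Ktac 𝓟} (f : X ⟶ Y) (φ : X.obj.as ⟶ Y.obj.as)
    (hφ : (HomotopyCategory.quotient 𝓟 (ComplexShape.up ℤ)).map φ = f.hom) :
    (beta 𝓟).map f = (Dst.Q 𝓟).map (truncMap X.property.1 Y.property.1 φ) :=
  Q_map_truncMap_eq_of_quotient_map_eq X.property.1 Y.property.1
    ((Quot.out_eq _).trans hφ.symm)

end Beta

section Modules

variable (A : Type u) [Ring A]

/-- The finitely generated projective left `A`-modules. -/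
def finiteProjective : ObjectProperty (ModuleCat.{u} A) :=
  fun M ↦ Module.Finite A M ∧ Module.Projective A M

/-- The category `proj A` of finitely generated projective left `A`-modules. -/
abbrev Proj := (finiteProjective A).FullSubcategory

instance : (finiteProjective A).ContainsZero where
  exists_zero := ⟨ModuleCat.of A PUnit, ModuleCat.isZero_of_subsingleton _,
    ⟨(inferInstance : Module.Finite A PUnit.{u + 1}), (inferInstance : Module.Projective A PUnit.{u + 1})⟩⟩

instance : (finiteProjective A).IsClosedUnderIsomorphisms where
  of_iso {M N} e h := by
    obtain ⟨_, _⟩ := h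
    exact ⟨Module.Finite.equiv e.toLinearEquiv, Module.Projective.of_equiv e.toLinearEquiv⟩

instance : (finiteProjective A).IsClosedUnderBinaryProducts where
  limitsOfShape_le := by
    rintro X ⟨p⟩
    obtain ⟨_, _⟩ := p.prop_diag_obj (.mk .left)
    obtain ⟨_, _⟩ := p.prop_diag_obj (.mk .right)
    let M := p.diag.obj (.mk .left)
    let N := p.diag.obj (.mk .right)
    let e : ModuleCat.of A (M × N) ≅ X :=
      IsLimit.conePointUniqueUpToIso (ModuleCat.binaryProductLimitCone M N).isLimit
        ((IsLimit.postcomposeHomEquiv (diagramIsoPair p.diag) _).2 p.isLimit)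
    exact (finiteProjective A).prop_of_iso e
      ⟨(inferInstance : Module.Finite A (M × N)), (inferInstance : Module.Projective A (M × N))⟩

instance : (finiteProjective A).IsClosedUnderFiniteProducts := .mk'

instance : HasBinaryBiproducts (Proj A) :=
  have : HasFiniteBiproducts (Proj A) := HasFiniteBiproducts.of_hasFiniteProducts
  hasBinaryBiproducts_of_finite_biproducts _

end Modules

end StableDerived
end

noncomputable section

open CategoryTheory Limits Pretriangulated ZeroObject

namespace StableDerived

/-! ### Null-homotopies built degree by degree. -/

section Homotopies

open CochainComplex CochainComplex.HomComplex

variable {C : Type u} [Category.{v} C] [Preadditive C]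

/-! Let `R` be a resolution of a finitely generated injective module `I` by finitely generated free
modules. Density gives a totally acyclic `T` whose truncation is isomorphic to `R` in the Verdier
quotient. Every map from `T` to a bounded complex is null-homotopic
(`IsTotallyAcyclic.leftOrthogonal_Kb`), so `Hom(T, -)` descends to that quotient and takes
isomorphic values on `brutalTrunc T` and `R`. But `Hom(T, R) = 0`, because `T` is acyclic and `I` is
injective (`Resolution.homotopy_zero`). Hence the projection `T ⟶ brutalTrunc T` is null-homotopic.

Truncating this null-homotopy loses only one component, so the identity of `brutalTrunc T` factors,
up to homotopy, through a stalk complex (`homotopy_id_brutalTrunc`). Thus `brutalTrunc T`, and with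
it `R`, is zero in the quotient. Vanishing there means that the identity of `R` factors up to
homotopy through a bounded complex; far to the left the homotopy then splits a differential onto its
image, so a high syzygy of `I` is projective (`projectiveDimension_lt_top_of_homotopy`). -/

lemma exists_cochain_extension {K L : CochainComplex C ℤ}
    (f : K ⟶ L) (α : Cochain K L (-1)) (n m : ℤ) (hnm : n + 1 = m)
    (hK : ∀ u : K.X m ⟶ L.X m, K.d n m ≫ u = 0 →
      ∃ h : K.X (m + 1) ⟶ L.X m, K.d m (m + 1) ≫ h = u)
    (hα : (δ (-1) 0 α).EqUpTo (Cochain.ofHom f) n) :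
    ∃ (h : K.X (n + 2) ⟶ L.X (n + 1)),
      (δ (-1) 0 (α + Cochain.single h (-1))).EqUpTo (Cochain.ofHom f) m := by
  subst hnm
  -- The defect of `α` as a homotopy in degree `n + 1`. As `α` is already correct in degree `n`, the
  -- defect is killed by the incoming differential, so it factors through the outgoing one; the
  -- factor is the correction.
  let u := f.f (n + 1) - α.v (n + 1) n (by lia) ≫ L.d n (n + 1) -
    K.d (n + 1) (n + 2) ≫ α.v (n + 2) (n + 1) (by lia)
  have hu : K.d n (n + 1) ≫ u = 0 := by
    have eq := hα n n (add_zero n) (by rfl)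
    simp only [δ_v (-1) 0 (neg_add_cancel 1) α n n (add_zero _) (n - 1) (n + 1)
      (by lia) (by lia), Int.negOnePow_zero, one_smul, Cochain.ofHom_v] at eq
    simp only [u, Preadditive.comp_sub, HomologicalComplex.d_comp_d_assoc, zero_comp,
      ← f.comm, ← eq, Preadditive.add_comp, Category.assoc, L.d_comp_d, comp_zero, zero_add,
      sub_self]
  obtain ⟨β, hβ⟩ : ∃ (β : K.X (n + 2) ⟶ L.X (n + 1)), K.d (n + 1) (n + 2) ≫ β = u := by
    rw [show n + 2 = n + 1 + 1 by ring]
    exact hK u hu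
  refine ⟨β, ?_⟩
  intro p q hpq hp
  obtain rfl : p = q := by lia
  obtain hp | rfl := hp.lt_or_eq
  · rw [δ_add, Cochain.add_v, hα p p (by lia) (by lia), add_eq_left,
      δ_v (-1) 0 (neg_add_cancel 1) _ p p hpq (p - 1) (p + 1) rfl rfl,
      Cochain.single_v_eq_zero _ _ _ _ _ (by lia),
      Cochain.single_v_eq_zero _ _ _ _ _ (by lia)]
    simp
  · rw [δ_v (-1) 0 (neg_add_cancel 1) _ (n + 1) (n + 1) (by lia) n (n + 2)
      (by lia) (by lia), Cochain.add_v,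
      Cochain.single_v_eq_zero _ _ _ _ _ (by lia)]
    simp [hβ, u]

open Cochain.InductionUp in
/-- A chain map that vanishes in low degrees is null-homotopic if every cocycle
`u : K.X m ⟶ L.X m` factors through the differential of `K`. -/
lemma homotopy_zero_of_descends {K L : CochainComplex C ℤ} (f : K ⟶ L) (d : ℤ)
    (hf : ∀ p < d, f.f p = 0)
    (hK : ∀ n m, n + 1 = m → d ≤ m → ∀ u : K.X m ⟶ L.X m, K.d n m ≫ u = 0 →
      ∃ h : K.X (m + 1) ⟶ L.X m, K.d m (m + 1) ≫ h = u) :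
    Nonempty (Homotopy f 0) := by
  let X (n : ℕ) : Set (Cochain K L (-1)) :=
    Set.ofPred (fun α => (δ (-1) 0 α).EqUpTo (Cochain.ofHom f) (n + d - 1))
  -- The zero cochain is a valid start: `f` vanishes in degrees `≤ d - 1`.
  let x₀ : X 0 := ⟨0, fun p q hpq hp ↦ by
    obtain rfl : p = q := by lia
    rw [δ_zero, Cochain.ofHom_v, hf p (by lia), Cochain.zero_v]⟩
  let φ (n : ℕ) (α : X n) : X (n + 1) :=
    ⟨_, (exists_cochain_extension f α.1 (n + d - 1) ((n + 1 : ℕ) + d - 1)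
      (by lia) (hK _ _ (by lia) (by lia)) α.2).choose_spec⟩
  -- Stage `k` changes only the component with source degree `d + k + 1`, so the partial homotopies
  -- stabilize.
  have hφ (k : ℕ) (x : X k) : (φ k x).1.EqUpTo x.1 (d + k) := fun p q hpq hp => by
    dsimp [φ]
    rw [add_eq_left, Cochain.single_v_eq_zero _ _ _ _ _ (by lia)]
  refine ⟨(Cochain.equivHomotopy f 0).symm ⟨limitSequence φ hφ x₀, ?_⟩⟩
  rw [Cochain.ofHom_zero, add_zero]
  ext n
  -- At this stage the homotopy equation holds in degree `n`, and the components out of degrees `n`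
  -- and `n + 1` are final.
  let k₀ := (n - d + 1).toNat
  rw [← (sequence φ x₀ k₀).2 n n (add_zero n) (by lia),
    δ_v (-1) 0 (neg_add_cancel 1) _ n n (by lia) (n - 1) (n + 1) rfl (by lia),
    δ_v (-1) 0 (neg_add_cancel 1) _ n n (by lia) (n - 1) (n + 1) rfl (by lia),
    limitSequence_eqUpTo φ hφ x₀ k₀ n (n - 1) (by lia) (by lia),
    limitSequence_eqUpTo φ hφ x₀ k₀ (n + 1) n (by lia) (by lia)]

/-- A chain map that vanishes in high degrees is null-homotopic if every cycle
`u : K.X m ⟶ L.X m` factors through the differential of `L`. -/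
lemma homotopy_zero_of_lifts {K L : CochainComplex C ℤ} (f : K ⟶ L) (d : ℤ)
    (hf : ∀ p, d < p → f.f p = 0)
    (hL : ∀ n m, m + 1 = n → m ≤ d → ∀ u : K.X m ⟶ L.X m, u ≫ L.d m n = 0 →
      ∃ h : K.X m ⟶ L.X (m - 1), h ≫ L.d (m - 1) m = u) :
    Nonempty (Homotopy f 0) := by
  -- In the opposite category degrees change sign and lifting through `L.d` becomes factoring
  -- through the first differential.
  obtain ⟨h⟩ := homotopy_zero_of_descends ((opEquivalence C).functor.map f.op) (-d)
    (fun p hp ↦ by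
      change (f.f (-p)).op = 0
      rw [hf _ (by lia)]; rfl)
    (fun n m hnm hm u hu ↦ by
      change Opposite.op (L.X (-m)) ⟶ Opposite.op (K.X (-m)) at u
      change (L.d (-m) (-n)).op ≫ u = 0 at hu
      have ex := hL (-n) (-m) (by lia) (by lia) u.unop (Quiver.Hom.op_inj hu)
      rw [show -m - 1 = -(m + 1) by ring] at ex
      obtain ⟨h, hh⟩ := ex
      exact ⟨h.op, Quiver.Hom.unop_inj hh⟩)
  exact ⟨homotopyUnop (h.trans (.ofEq (by simp)))⟩

end Homotopies

/-! ### Totally acyclic complexes and the Verdier quotient. -/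

section TotallyAcyclic

variable {𝓟 : Type u} [Category.{v} 𝓟] [Preadditive 𝓟]

lemma homFrom_exactAt_iff (C : CochainComplex 𝓟 ℤ) (P : 𝓟) (i j k : ℤ) (hij : i + 1 = j)
    (hjk : j + 1 = k) : (homFrom C P).ExactAt j ↔
      ∀ f : C.X j ⟶ P, C.d i j ≫ f = 0 → ∃ g : C.X k ⟶ P, C.d j k ≫ g = f := by
  rw [HomologicalComplex.exactAt_iff' _ k j i (ComplexShape.prev_eq' _ hjk)
      (ComplexShape.next_eq' _ hij),
    ShortComplex.ab_exact_iff]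
  rfl

/-- Exactness of `Hom(T, B.X j)` is the factorization needed at each inductive step; the lower bound
of `B` provides the start. -/
lemma IsTotallyAcyclic.homotopy_zero {T B : CochainComplex 𝓟 ℤ} (hT : IsTotallyAcyclic T)
    (m : ℤ) (hB : B.IsStrictlyGE m) (f : T ⟶ B) : Nonempty (Homotopy f 0) :=
  homotopy_zero_of_descends f m
    (fun p hp ↦ (CochainComplex.isZero_of_isStrictlyGE B m p hp).eq_of_tgt _ _)
    (fun i j hij _ u hu ↦ (homFrom_exactAt_iff T (B.X j) i j (j + 1) hij rfl).1 (hT.2 _ j) u hu)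

/-- This orthogonality is what makes `Hom(T, -)` descend to the Verdier quotient. -/
lemma IsTotallyAcyclic.leftOrthogonal_Kb {T : CochainComplex 𝓟 ℤ} (hT : IsTotallyAcyclic T) :
    (Kb 𝓟).leftOrthogonal ((HomotopyCategory.quotient _ _).obj T) := by
  rintro Y f ⟨B, ⟨m, n, hm, -⟩, ⟨e⟩⟩
  obtain ⟨B : CochainComplex _ _, rfl⟩ := B.quotient_obj_surjective
  obtain ⟨g, hg⟩ := (HomotopyCategory.quotient 𝓟 (ComplexShape.up ℤ)).map_surjective (f ≫ e.hom)
  obtain ⟨H⟩ := hT.homotopy_zero m hm g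
  exact (cancel_mono e.hom).1 (hg.symm.trans
    ((HomotopyCategory.eq_of_homotopy _ _ H).trans (by simp only [Functor.map_zero, zero_comp]; rfl)))

lemma isEventuallyAcyclic_of_bounded (Z : CochainComplex 𝓟 ℤ) (m n : ℤ) (hm : Z.IsStrictlyGE m)
    (hn : Z.IsStrictlyLE n) : IsEventuallyAcyclic Z := by
  intro P
  refine ⟨m.natAbs + n.natAbs, fun i hi ↦ ?_⟩
  rw [homTo_exactAt_iff P Z (i - 1) i (i + 1) (by ring) (by ring)]
  have hz : IsZero (Z.X i) := by
    rcases abs_cases i with h | h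
    · exact CochainComplex.isZero_of_isStrictlyLE Z n i (by omega)
    · exact CochainComplex.isZero_of_isStrictlyGE Z m i (by omega)
  exact fun f _ ↦ ⟨0, hz.eq_of_tgt _ _⟩

variable [HasZeroObject 𝓟]

/-- The projection from a complex to its brutal truncation. -/
def toBrutalTrunc (T : CochainComplex 𝓟 ℤ) : T ⟶ brutalTrunc T :=
  (ComplexShape.embeddingUpIntLE 0).liftExtend (𝟙 _)
    -- No differential enters degrees `≤ 0` from degrees `> 0`, so there is no boundary condition to
    -- check.
    (fun j hj _ _ ↦ (hj.2 (j + 1) (by simp)).elim)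

/-- Brutal truncation is idempotent: the projection is an isomorphism in degrees `≤ 0`, and both
truncations vanish elsewhere. -/
instance isIso_brutalTruncMap_toBrutalTrunc (T : CochainComplex 𝓟 ℤ) :
    IsIso (brutalTruncMap (toBrutalTrunc T)) := by
  have (i : ℤ) : IsIso ((brutalTruncMap (toBrutalTrunc T)).f i) := by
    by_cases hi : ∃ k, (ComplexShape.embeddingUpIntLE 0).f k = i
    · obtain ⟨k, hk⟩ := hi
      have : IsIso ((toBrutalTrunc T).f i) :=
        (ComplexShape.Embedding.isIso_liftExtend_f_iff _ _ _ hk).2 (by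
          change IsIso (𝟙 _); infer_instance)
      have h := HomologicalComplex.stupidTruncMap_stupidTruncXIso_hom (toBrutalTrunc T)
        (ComplexShape.embeddingUpIntLE 0) hk
      rw [← Iso.eq_comp_inv] at h
      rw [h]
      infer_instance
    · have hz (C : CochainComplex 𝓟 ℤ) : IsZero ((brutalTrunc C).X i) :=
        HomologicalComplex.isZero_stupidTrunc_X _ _ i (by simpa using hi)
      exact ⟨0, (hz _).eq_of_src _ _, (hz _).eq_of_src _ _⟩
  exact HomologicalComplex.Hom.isIso_of_components _

/-- If the projection `T ⟶ brutalTrunc T` is null-homotopic, then the identity of `brutalTrunc T`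
factors, up to homotopy, through a stalk complex. -/
lemma homotopy_id_brutalTrunc {T : CochainComplex 𝓟 ℤ} (h : Homotopy (toBrutalTrunc T) 0) :
    ∃ (Z : CochainComplex 𝓟 ℤ) (_ : Z.IsStrictlyGE 0) (_ : Z.IsStrictlyLE 0)
      (a : brutalTrunc T ⟶ Z) (b : Z ⟶ brutalTrunc T),
      Nonempty (Homotopy (𝟙 (brutalTrunc T)) (a ≫ b)) := by
  -- The homotopy component out of degree `1` is lost under truncation; its contribution in degree
  -- `0` is the map through `Z`.
  obtain ⟨Z, hZ, hZ', a, b, ⟨H⟩⟩ := brutalTrunc_homotopy h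
  refine ⟨Z, hZ, hZ', a, b ≫ inv (brutalTruncMap (toBrutalTrunc T)), ⟨?_⟩⟩
  refine (Homotopy.ofEq (by simp)).trans
    ((H.compRight (inv (brutalTruncMap (toBrutalTrunc T)))).trans (Homotopy.ofEq ?_))
  have : brutalTruncMap (0 : T ⟶ brutalTrunc T) = 0 := by
    simp only [brutalTruncMap, HomologicalComplex.stupidTruncMap]
    rw [show HomologicalComplex.restrictionMap (0 : T ⟶ brutalTrunc T)
      (ComplexShape.embeddingUpIntLE 0) = 0 from rfl, HomologicalComplex.extendMap_zero]
    rfl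
  rw [this, zero_add, Category.assoc]

variable [HasBinaryBiproducts 𝓟]

/-- Morphisms from a totally acyclic complex to objects of `K^{-,b}(𝓟)`. -/
abbrev homFromTac (T : CochainComplex 𝓟 ℤ) : KminusbCat 𝓟 ⥤ Type v :=
  (Kminusb 𝓟).ι ⋙ coyoneda.obj (Opposite.op ((HomotopyCategory.quotient _ _).obj T))

/-- An object left orthogonal to `Kb` is colocal: composing with a morphism whose cone lies in `Kb`
is bijective on morphisms out of it. -/
lemma IsTotallyAcyclic.homFromTac_inverts {T : CochainComplex 𝓟 ℤ} (hT : IsTotallyAcyclic T) :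
    (KbInKminusb 𝓟).trW.IsInvertedBy (homFromTac T) := by
  intro X Y s hs
  have hs' : (Kb 𝓟).trW ((Kminusb 𝓟).ι.map s) :=
    (ObjectProperty.inverseImage_trW_iff (Kb 𝓟) (Kminusb 𝓟).ι s).1 hs
  have h := hT.leftOrthogonal_Kb
  rw [← ObjectProperty.isColocal_trW] at h
  exact (isIso_iff_bijective _).2 (h _ hs')

/-- Vanishing of all morphisms from a totally acyclic complex only depends on the image in the
Verdier quotient. -/
lemma IsTotallyAcyclic.subsingleton_of_iso {T : CochainComplex 𝓟 ℤ} (hT : IsTotallyAcyclic T)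
    {X Y : KminusbCat 𝓟} (e : (Dst.Q 𝓟).obj X ≅ (Dst.Q 𝓟).obj Y)
    (hY : Subsingleton ((homFromTac T).obj Y)) : Subsingleton ((homFromTac T).obj X) := by
  let α := eqToIso (Localization.Construction.fac (homFromTac T) hT.homFromTac_inverts)
  let e' : (homFromTac T).obj X ≅ (homFromTac T).obj Y := (α.app X).symm ≪≫
    (Localization.Construction.lift (homFromTac T) hT.homFromTac_inverts).mapIso e ≪≫ α.app Y
  exact e'.toEquiv.subsingleton

/-- An object that is a retract, up to homotopy, of a bounded complex vanishes in the Verdier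
quotient. -/
lemma isZero_Q_of_factorization (X : KminusbCat 𝓟) (Z : CochainComplex 𝓟 ℤ) (m n : ℤ)
    (hm : Z.IsStrictlyGE m) (hn : Z.IsStrictlyLE n)
    (a : X.obj ⟶ (HomotopyCategory.quotient _ _).obj Z)
    (b : (HomotopyCategory.quotient _ _).obj Z ⟶ X.obj) (hab : 𝟙 _ = a ≫ b) :
    IsZero ((Dst.Q 𝓟).obj X) := by
  rw [IsZero.iff_id_eq_zero, ← Functor.map_zero (Dst.Q 𝓟)]
  let Z₀ : KminusbCat 𝓟 := ⟨(HomotopyCategory.quotient _ _).obj Z,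
    ObjectProperty.le_isoClosure _ _ ⟨⟨n, hn⟩, isEventuallyAcyclic_of_bounded Z m n hm hn⟩⟩
  rw [← CategoryTheory.Functor.map_id]
  refine Q_map_eq_of_factor (Z := Z₀) _ _
    (ObjectProperty.le_isoClosure _ _ ⟨m, n, hm, hn⟩)
    (ObjectProperty.homMk a) (ObjectProperty.homMk b) ?_
  rw [zero_add]
  exact ObjectProperty.hom_ext _ hab

/-- An object that vanishes in the Verdier quotient is a retract, up to homotopy, of a
bounded complex. -/
lemma exists_factorization_of_isZero_Q (X : KminusbCat 𝓟)
    (h : IsZero ((Dst.Q 𝓟).obj X)) :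
    ∃ (B : CochainComplex 𝓟 ℤ) (m : ℤ) (_ : B.IsStrictlyGE m)
      (a : X.obj ⟶ (HomotopyCategory.quotient _ _).obj B)
      (b : (HomotopyCategory.quotient _ _).obj B ⟶ X.obj), 𝟙 _ = a ≫ b := by
  rw [IsZero.iff_id_eq_zero, ← Functor.map_zero (Dst.Q 𝓟),
    ← CategoryTheory.Functor.map_id, MorphismProperty.map_eq_iff_precomp _ (KbInKminusb 𝓟).trW] at h
  obtain ⟨W, s, ⟨Z, g, k, hT, hZ⟩, hs⟩ := h
  rw [Category.comp_id, comp_zero] at hs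
  -- Equality of `𝟙 X` and `0` in the quotient forces some `s` with cone `Z` in `Kb` to be zero, so
  -- `𝟙 X` factors through that cone.
  obtain ⟨φ, hφ⟩ := Triangle.yoneda_exact₂ _ hT (𝟙 X) (by
    change s ≫ 𝟙 X = 0
    rw [hs]; exact zero_comp)
  change Z ⟶ X at φ
  change 𝟙 X = g ≫ φ at hφ
  obtain ⟨B, ⟨m, n, hm, -⟩, ⟨e⟩⟩ := hZ
  obtain ⟨B : CochainComplex _ _, rfl⟩ := B.quotient_obj_surjective
  change Z.obj ≅ _ at e
  refine ⟨B, m, hm, g.hom ≫ e.hom, e.inv ≫ φ.hom, ?_⟩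
  have := congrArg (fun f ↦ f.hom) hφ
  simpa using! this

end TotallyAcyclic

/-! ### Finitely generated projective modules and their maps. -/

section Modules

variable {A : Type u} [Ring A]

/-- The linear map underlying a morphism of `proj A`. -/
abbrev lin {X Y : Proj A} (f : X ⟶ Y) : X.obj →ₗ[A] Y.obj := f.hom.hom

/-- The morphism of `proj A` given by a linear map. -/
abbrev ofLin {X Y : Proj A} (f : X.obj →ₗ[A] Y.obj) : X ⟶ Y :=
  ObjectProperty.homMk (ModuleCat.ofHom f)

lemma lin_comp_apply {X Y Z : Proj A} (f : X ⟶ Y) (g : Y ⟶ Z) (x : X.obj) :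
    lin (f ≫ g) x = lin g (lin f x) := rfl

lemma lin_injective {X Y : Proj A} : Function.Injective (lin (X := X) (Y := Y)) :=
  fun _ _ h ↦ ObjectProperty.hom_ext _ (ModuleCat.hom_ext h)

instance (X : Proj A) : Module.Finite A X.obj := X.property.1
instance (X : Proj A) : Module.Projective A X.obj := X.property.2

/-- Projectivity is applied to the corestriction of `p` to its range, so `p` itself need not be
surjective. -/
lemma exists_lift (Q : Proj A) {X : Type u} [AddCommGroup X] [Module A X]
    {N : Type u} [AddCommGroup N] [Module A N] (p : X →ₗ[A] N) (f : Q.obj →ₗ[A] N)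
    (h : ∀ x, f x ∈ LinearMap.range p) : ∃ g : Q.obj →ₗ[A] X, ∀ x, p (g x) = f x := by
  obtain ⟨g, hg⟩ := Module.projective_lifting_property p.rangeRestrict
    (f.codRestrict (LinearMap.range p) h) p.surjective_rangeRestrict
  exact ⟨g, fun x ↦ congrArg Subtype.val (LinearMap.congr_fun hg x)⟩

variable (A) in
/-- The regular module as an object of `proj A`. -/
abbrev regular : Proj A :=
  ⟨ModuleCat.of A A, (inferInstance : Module.Finite A A), (inferInstance : Module.Projective A A)⟩

/-- Elements are maps from the regular module, so exactness tested against `proj A` gives exactness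
on elements. -/
lemma exists_preimage {X Y Z : Proj A} (f : X ⟶ Y) (g : Y ⟶ Z)
    (h : ∀ u : regular A ⟶ Y, u ≫ g = 0 → ∃ v, v ≫ f = u) (y : Y.obj) (hy : lin g y = 0) :
    ∃ x, lin f x = y := by
  obtain ⟨v, hv⟩ := h (ofLin (LinearMap.toSpanSingleton A Y.obj y)) (lin_injective (by
    ext
    change lin g (LinearMap.toSpanSingleton A Y.obj y 1) = 0
    simpa using hy))
  refine ⟨lin v (1 : A), ?_⟩
  rw [← lin_comp_apply, hv]
  exact LinearMap.toSpanSingleton_apply_one ..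

/-! ### Finiteness of projective dimension along short exact sequences. -/

section ProjectiveDimension

lemma projectiveDimension_lt_top_of_surjective {P N : Type u} [AddCommGroup P] [Module A P]
    [AddCommGroup N] [Module A N] [Module.Projective A P] (g : P →ₗ[A] N)
    (hg : Function.Surjective g)
    (h : projectiveDimension (ModuleCat.of A (LinearMap.ker g)) < ⊤) :
    projectiveDimension (ModuleCat.of A N) < ⊤ := by
  rw [lt_top_iff_ne_top, projectiveDimension_ne_top_iff] at h ⊢
  obtain ⟨n, hn⟩ := h
  let S : ShortComplex (ModuleCat.{u} A) := ShortComplex.mk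
    (ModuleCat.ofHom (LinearMap.ker g).subtype) (ModuleCat.ofHom g) (by ext x; exact x.2)
  have hS : S.ShortExact :=
    { exact := (ShortComplex.moduleCat_exact_iff S).2 fun x hx ↦ ⟨⟨x, hx⟩, rfl⟩
      mono_f := (ModuleCat.mono_iff_injective _).2 Subtype.val_injective
      epi_g := (ModuleCat.epi_iff_surjective _).2 hg }
  have : Projective S.X₂ := inferInstanceAs (Projective (ModuleCat.of A P))
  exact ⟨n + 1, hS.hasProjectiveDimensionLT_X₃ (n + 1) hn
    (hasProjectiveDimensionLT_of_ge S.X₂ 1 _ (by omega))⟩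

lemma projectiveDimension_lt_top_of_projective (P : Type u) [AddCommGroup P] [Module A P]
    [Module.Projective A P] : projectiveDimension (ModuleCat.of A P) < ⊤ := by
  rw [lt_top_iff_ne_top, projectiveDimension_ne_top_iff]
  exact ⟨0, inferInstance⟩

end ProjectiveDimension

/-! ### Free resolutions over a Noetherian ring. -/

section Resolution

/-- A complex in `proj A` that is a projective resolution of `M`, in cohomological degrees
`≤ 0`. -/
structure Resolution (M : Type u) [AddCommGroup M] [Module A M] where
  complex : CochainComplex (Proj A) ℤ
  isStrictlyLE : complex.IsStrictlyLE 0
  ε : (complex.X 0).obj →ₗ[A] M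
  ε_surjective : Function.Surjective ε
  ε_d : ∀ x, ε (lin (complex.d (-1) 0) x) = 0
  -- Exactness is stated as lifting against `proj A`, which need not have kernels.
  exact_zero : ∀ (Q : Proj A) (f : Q ⟶ complex.X 0), (∀ x, ε (lin f x) = 0) →
    ∃ g, g ≫ complex.d (-1) 0 = f
  exact_neg : ∀ i j k : ℤ, i + 1 = j → j + 1 = k → j < 0 →
    ∀ (Q : Proj A) (f : Q ⟶ complex.X j), f ≫ complex.d j k = 0 → ∃ g, g ≫ complex.d i j = f

variable (A) in
/-- Finitely generated modules. -/
abbrev FinModule := { M : ModuleCat.{u} A // Module.Finite A M }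

instance (M : FinModule A) : Module.Finite A M.1 := M.2

/-- A finitely generated free module that surjects onto `M`. -/
def cover (M : FinModule A) : Proj A :=
  ⟨ModuleCat.of A (Fin (Module.Finite.exists_fin' A M.1).choose → A),
    (inferInstance : Module.Finite A (Fin (Module.Finite.exists_fin' A M.1).choose → A)),
    (inferInstance : Module.Projective A (Fin (Module.Finite.exists_fin' A M.1).choose → A))⟩

/-- The surjection from the free cover of `M`. -/
def coverMap (M : FinModule A) : (cover M).obj →ₗ[A] M.1 :=
  (Module.Finite.exists_fin' A M.1).choose_spec.choose

lemma coverMap_surjective (M : FinModule A) : Function.Surjective (coverMap M) :=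
  (Module.Finite.exists_fin' A M.1).choose_spec.choose_spec

variable [IsNoetherianRing A]

/-- The iterated syzygies of a finitely generated module. -/
def syzygy (M : FinModule A) : ℕ → FinModule A
  | 0 => M
  -- Noetherianity keeps the kernel finitely generated, so the recursion can continue.
  | n + 1 => ⟨ModuleCat.of A (LinearMap.ker (coverMap (syzygy M n))),
      (inferInstance : Module.Finite A (LinearMap.ker (coverMap (syzygy M n))))⟩

/-- The differentials of the free resolution. -/
def syzygyMap (M : FinModule A) (n : ℕ) : cover (syzygy M (n + 1)) ⟶ cover (syzygy M n) :=
  ofLin ((LinearMap.ker (coverMap (syzygy M n))).subtype ∘ₗ coverMap (syzygy M (n + 1)))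

lemma coverMap_syzygyMap (M : FinModule A) (n : ℕ) (x : (cover (syzygy M (n + 1))).obj) :
    coverMap (syzygy M n) (lin (syzygyMap M n) x) = 0 :=
  (coverMap (syzygy M (n + 1)) x).2

lemma exists_lift_syzygyMap (M : FinModule A) (n : ℕ) (Q : Proj A) (f : Q ⟶ cover (syzygy M n))
    (hf : ∀ x, coverMap (syzygy M n) (lin f x) = 0) : ∃ g, g ≫ syzygyMap M n = f := by
  obtain ⟨g, hg⟩ := exists_lift Q (lin (syzygyMap M n)) (lin f) (fun x ↦ by
    obtain ⟨y, hy⟩ := coverMap_surjective (syzygy M (n + 1)) ⟨lin f x, hf x⟩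
    exact ⟨y, congrArg Subtype.val hy⟩)
  exact ⟨ofLin g, lin_injective (LinearMap.ext hg)⟩

/-- The free resolution as a chain complex indexed by `ℕ`. -/
def freeResolution (M : FinModule A) : ChainComplex (Proj A) ℕ :=
  ChainComplex.of (fun n ↦ cover (syzygy M n)) (syzygyMap M) (fun n ↦ lin_injective (by
    ext x
    change ((coverMap (syzygy M (n + 1)) (lin (syzygyMap M (n + 1)) x)).1 :
      (cover (syzygy M n)).obj) = 0
    rw [coverMap_syzygyMap]
    rfl))

lemma freeResolution_d (M : FinModule A) (n : ℕ) :
    (freeResolution M).d (n + 1) n = syzygyMap M n :=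
  ChainComplex.of_d (fun n ↦ cover (syzygy M n)) (syzygyMap M) n

lemma freeResolution_exact (M : FinModule A) (n : ℕ) (Q : Proj A)
    (f : Q ⟶ (freeResolution M).X (n + 1)) (hf : f ≫ (freeResolution M).d (n + 1) n = 0) :
    ∃ g, g ≫ (freeResolution M).d (n + 2) (n + 1) = f := by
  rw [freeResolution_d] at hf ⊢
  refine exists_lift_syzygyMap M (n + 1) Q f fun x ↦ Subtype.ext ?_
  exact LinearMap.congr_fun (congrArg lin hf) x

/-- A chain complex in `proj A`, indexed by `ℕ`, that resolves `M` gives a resolution indexed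
by the integers. -/
def Resolution.ofChainComplex {M : Type u} [AddCommGroup M] [Module A M]
    (R : ChainComplex (Proj A) ℕ) (ε : (R.X 0).obj →ₗ[A] M) (hε : Function.Surjective ε)
    (hd : ∀ x, ε (lin (R.d 1 0) x) = 0)
    (h₀ : ∀ (Q : Proj A) (f : Q ⟶ R.X 0), (∀ x, ε (lin f x) = 0) → ∃ g, g ≫ R.d 1 0 = f)
    (h : ∀ (n : ℕ) (Q : Proj A) (f : Q ⟶ R.X (n + 1)), f ≫ R.d (n + 1) n = 0 →
      ∃ g, g ≫ R.d (n + 2) (n + 1) = f) :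
    Resolution (A := A) M :=
  let e := ComplexShape.embeddingUpIntLE 0
  have e₀ : e.f 0 = 0 := by simp [e]
  have e₁ : e.f 1 = -1 := by simp [e]
  { complex := R.extend e
    isStrictlyLE := inferInstance
    ε := ε.comp (lin (R.extendXIso e e₀).hom)
    ε_surjective := by
      rw [LinearMap.coe_comp]
      refine hε.comp fun x ↦ ⟨lin (R.extendXIso e e₀).inv x, ?_⟩
      rw [← lin_comp_apply, Iso.inv_hom_id]
      rfl
    ε_d := fun x ↦ by
      rw [LinearMap.comp_apply, ← lin_comp_apply, R.extend_d_eq e e₁ e₀, Category.assoc,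
        Category.assoc, Iso.inv_hom_id, Category.comp_id, lin_comp_apply]
      exact hd _
    exact_zero := fun Q f hf ↦ by
      obtain ⟨g, hg⟩ := h₀ Q (f ≫ (R.extendXIso e e₀).hom) hf
      refine ⟨g ≫ (R.extendXIso e e₁).inv, ?_⟩
      rw [R.extend_d_eq e e₁ e₀, Category.assoc, Iso.inv_hom_id_assoc, reassoc_of% hg,
        Iso.hom_inv_id, Category.comp_id]
    exact_neg := fun i j k hij hjk hj Q f hf ↦ by
      obtain ⟨n, rfl⟩ : ∃ n : ℕ, j = -(n + 1 : ℤ) := ⟨(-j - 1).toNat, by omega⟩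
      have hi : e.f (n + 2) = i := by simp [e]; omega
      have hj : e.f (n + 1) = -(n + 1 : ℤ) := by simp [e]
      have hk : e.f n = k := by simp [e]; omega
      rw [R.extend_d_eq e hj hk] at hf
      obtain ⟨g, hg⟩ := h n Q (f ≫ (R.extendXIso e hj).hom) (by
        rw [← cancel_mono (R.extendXIso e hk).inv]
        simpa using! hf)
      refine ⟨g ≫ (R.extendXIso e hi).inv, ?_⟩
      rw [R.extend_d_eq e hi hj, Category.assoc, Iso.inv_hom_id_assoc, reassoc_of% hg,
        Iso.hom_inv_id, Category.comp_id] }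

/-- The free resolution of a finitely generated module over a Noetherian ring. -/
def resolution (M : Type u) [AddCommGroup M] [Module A M] [Module.Finite A M] :
    Resolution (A := A) M :=
  let M₀ : FinModule A := ⟨ModuleCat.of A M, ‹_›⟩
  .ofChainComplex (freeResolution M₀) (coverMap M₀) (coverMap_surjective M₀)
    (by rw [freeResolution_d]; exact coverMap_syzygyMap M₀ 0)
    (by rw [freeResolution_d]; exact exists_lift_syzygyMap M₀ 0) (freeResolution_exact M₀)

end Resolution

end Modules

/-! ### Resolutions of injective modules. -/

section Injective

variable {A : Type u} [Ring A]

namespace Resolution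

variable {M : Type u} [AddCommGroup M] [Module A M] (R : Resolution (A := A) M)

lemma kminusb : Kminusb (Proj A) ((HomotopyCategory.quotient _ _).obj R.complex) := by
  refine ObjectProperty.le_isoClosure _ _ ⟨⟨0, R.isStrictlyLE⟩, fun Q ↦ ⟨0, fun n hn ↦ ?_⟩⟩
  change (homTo Q R.complex).ExactAt n
  rw [homTo_exactAt_iff Q _ (n - 1) n (n + 1) (by ring) (by ring)]
  intro f hf
  have := R.isStrictlyLE
  rcases lt_or_gt_of_ne (abs_pos.1 hn) with h | h
  · exact R.exact_neg _ _ _ (by ring) rfl h Q f hf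
  · exact ⟨0, (CochainComplex.isZero_of_isStrictlyLE R.complex 0 n h).eq_of_tgt _ _⟩

/-- The resolution as an object of `K^{-,b}(proj A)`. -/
def toKminusb : KminusbCat (Proj A) :=
  ⟨(HomotopyCategory.quotient _ _).obj R.complex, R.kminusb⟩

lemma ker_eq_range {i j k : ℤ} (hij : i + 1 = j) (hjk : j + 1 = k) (hj : j < 0) :
    LinearMap.ker (lin (R.complex.d j k)) = LinearMap.range (lin (R.complex.d i j)) := by
  refine le_antisymm (fun y hy ↦ exists_preimage _ _ (R.exact_neg i j k hij hjk hj _) y hy) ?_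
  rintro _ ⟨x, rfl⟩
  rw [LinearMap.mem_ker, ← lin_comp_apply, R.complex.d_comp_d]
  rfl

lemma ker_ε_eq_range : LinearMap.ker R.ε = LinearMap.range (lin (R.complex.d (-1) 0)) := by
  refine le_antisymm (fun y hy ↦ ?_) ?_
  · obtain ⟨v, hv⟩ := R.exact_zero (regular A) (ofLin (LinearMap.toSpanSingleton A _ y))
      (fun a ↦ by
        change R.ε (LinearMap.toSpanSingleton A _ y a) = 0
        rw [LinearMap.toSpanSingleton_apply, map_smul, LinearMap.mem_ker.1 hy, smul_zero])
    refine ⟨lin v (1 : A), ?_⟩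
    rw [← lin_comp_apply, hv]
    exact LinearMap.toSpanSingleton_apply_one ..
  · rintro _ ⟨x, rfl⟩
    exact R.ε_d x

/-- If one of the images of the differentials has finite projective dimension, so does the
resolved module. -/
lemma projectiveDimension_lt_top (n : ℕ)
    (h : projectiveDimension (ModuleCat.of A
      (LinearMap.range (lin (R.complex.d (-(n : ℤ) - 1) (-n))))) < ⊤) :
    projectiveDimension (ModuleCat.of A M) < ⊤ := by
  induction n with
  | zero =>
    refine projectiveDimension_lt_top_of_surjective R.ε R.ε_surjective ?_
    rw [R.ker_ε_eq_range]
    exact h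
  | succ n ih =>
    refine ih (projectiveDimension_lt_top_of_surjective
      (lin (R.complex.d (-(n : ℤ) - 1) (-n))).rangeRestrict
      (LinearMap.surjective_rangeRestrict _) ?_)
    rw [LinearMap.ker_rangeRestrict, R.ker_eq_range (i := -((n + 1 : ℕ) : ℤ) - 1)
      (by push_cast; ring) (by ring) (by omega)]
    rwa [show -((n + 1 : ℕ) : ℤ) = -(n : ℤ) - 1 by push_cast; ring] at h ⊢

/-- If the identity of the resolution is homotopic to a map that vanishes in low degrees, then the
resolved module has finite projective dimension. -/
lemma projectiveDimension_lt_top_of_homotopy (f : R.complex ⟶ R.complex) (m : ℤ)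
    (hf : ∀ p < m, f.f p = 0) (H : Homotopy (𝟙 R.complex) f) :
    projectiveDimension (ModuleCat.of A M) < ⊤ := by
  -- This choice puts degree `-n - 1` strictly below `m`, where `f` vanishes.
  let n : ℕ := m.natAbs
  refine R.projectiveDimension_lt_top n ?_
  let i : ℤ := -n - 1
  let j : ℤ := -n
  have hij : i + 1 = j := by simp [i, j]
  let d := lin (R.complex.d i j)
  have hH := H.comm i
  rw [hf i (by omega), dNext_eq _ (show (ComplexShape.up ℤ).Rel i j from hij),
    prevD_eq _ (show (ComplexShape.up ℤ).Rel (i - 1) i from by simp), add_zero,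
    HomologicalComplex.id_f] at hH
  -- In degree `i` the homotopy `h` gives `1 = dh + hd`; composing with `d` leaves `d h d = d`, so
  -- `h` splits `d` onto its image.
  have key (x : (R.complex.X i).obj) : d (lin (H.hom j i) (d x)) = d x := by
    have h : R.complex.d i j ≫ H.hom j i ≫ R.complex.d i j = R.complex.d i j := by
      conv_rhs => rw [← Category.id_comp (R.complex.d i j), hH]
      simp
    exact LinearMap.congr_fun (congrArg lin h) x
  have : Module.Projective A (LinearMap.range d) :=
    .of_split (lin (H.hom j i) ∘ₗ (LinearMap.range d).subtype) d.rangeRestrict (by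
      ext ⟨_, x, rfl⟩
      exact key x)
  exact projectiveDimension_lt_top_of_projective (LinearMap.range d)

end Resolution

lemma IsAcyclic.ker_eq_range {T : CochainComplex (Proj A) ℤ} (hT : IsAcyclic T) {i j k : ℤ}
    (hij : i + 1 = j) (hjk : j + 1 = k) :
    LinearMap.ker (lin (T.d j k)) = LinearMap.range (lin (T.d i j)) := by
  refine le_antisymm (fun y hy ↦ exists_preimage _ _
    ((homTo_exactAt_iff _ T i j k hij hjk).1 (hT _ j)) y hy) ?_
  rintro _ ⟨x, rfl⟩
  rw [LinearMap.mem_ker, ← lin_comp_apply, T.d_comp_d]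
  rfl

/-- A linear map into an injective module that vanishes on the kernel of `d` factors
through `d`. -/
lemma exists_extension_of_ker_le {X Y I : Type u} [AddCommGroup X] [Module A X] [AddCommGroup Y]
    [Module A Y] [AddCommGroup I] [Module A I] [Module.Injective A I] (d : X →ₗ[A] Y)
    (φ : X →ₗ[A] I) (h : LinearMap.ker d ≤ LinearMap.ker φ) : ∃ ψ : Y →ₗ[A] I, ψ ∘ₗ d = φ := by
  -- Injectivity is applied to the embedding of `X / ker d` into `Y`.
  obtain ⟨ψ, hψ⟩ := Module.Injective.out ((LinearMap.ker d).liftQ d le_rfl)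
    (LinearMap.ker_eq_bot.1 (Submodule.ker_liftQ_eq_bot _ _ _ le_rfl))
    ((LinearMap.ker d).liftQ φ h)
  exact ⟨ψ, LinearMap.ext fun x ↦ hψ (Submodule.Quotient.mk x)⟩

/-- Maps from a totally acyclic complex to a resolution of an injective module are
null-homotopic. -/
lemma Resolution.homotopy_zero {I : Type u} [AddCommGroup I] [Module A I] [Module.Injective A I]
    (R : Resolution (A := A) I) {T : CochainComplex (Proj A) ℤ} (hT : IsAcyclic T)
    (f : T ⟶ R.complex) : Nonempty (Homotopy f 0) := by
  have := R.isStrictlyLE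
  -- The composite of `f.f 0` with `ε` kills the image of `T.d (-1) 0`, which is the kernel of `T.d
  -- 0 1`; injectivity of `I` extends it over `T.X 1`.
  obtain ⟨ψ, hψ⟩ := exists_extension_of_ker_le (lin (T.d 0 1)) (R.ε ∘ₗ lin (f.f 0)) (by
    rw [hT.ker_eq_range (i := -1) (by norm_num) (by norm_num)]
    rintro _ ⟨x, rfl⟩
    rw [LinearMap.mem_ker, LinearMap.comp_apply, ← lin_comp_apply, ← f.comm, lin_comp_apply]
    exact R.ε_d _)
  obtain ⟨h₁, hh₁⟩ := exists_lift (T.X 1) R.ε ψ (fun x ↦ R.ε_surjective _)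
  obtain ⟨h₀, hh₀⟩ := R.exact_zero _ (f.f 0 - T.d 0 1 ≫ ofLin h₁) (fun x ↦ by
    change R.ε (lin (f.f 0) x - h₁ (lin (T.d 0 1) x)) = 0
    rw [map_sub, hh₁, sub_eq_zero]
    exact (LinearMap.congr_fun hψ x).symm)
  -- Only the components `1 → 0` and `0 → -1` are nonzero. They remove `f` in degree `0`; in
  -- negative degrees exactness of the resolution completes the homotopy.
  let hom : ∀ i j, T.X i ⟶ R.complex.X j :=
    Function.update (Function.update 0 0 (Function.update 0 (-1) h₀)) 1
      (Function.update 0 0 (ofLin h₁))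
  have hom₁ : hom 1 0 = ofLin h₁ := by simp [hom]
  have hom₀ : hom 0 (-1) = h₀ := by simp [hom]
  have zero (i j) (hij : ¬ (ComplexShape.up ℤ).Rel j i) : hom i j = 0 := by
    simp only [ComplexShape.up_Rel] at hij
    by_cases h : i = 1
    · subst h
      simp [hom, Function.update_of_ne (show j ≠ 0 by omega)]
    · by_cases h' : i = 0
      · subst h'
        simp [hom, Function.update_of_ne (show j ≠ -1 by omega)]
      · simp [hom, h, h']
  let N := Homotopy.nullHomotopicMap hom
  have hN : (f - N).f 0 = 0 := by
    rw [HomologicalComplex.sub_f_apply, Homotopy.nullHomotopicMap_f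
      (show (ComplexShape.up ℤ).Rel (-1) 0 by simp) (show (ComplexShape.up ℤ).Rel 0 1 by simp),
      hom₁, hom₀, hh₀]
    abel
  obtain ⟨H⟩ := homotopy_zero_of_lifts (f - N) (-1)
    (fun p hp ↦ by
      obtain rfl | hp := eq_or_lt_of_le (show 0 ≤ p by omega)
      · exact hN
      · exact (CochainComplex.isZero_of_isStrictlyLE R.complex 0 p hp).eq_of_tgt _ _)
    (fun n m hmn hm u hu ↦ R.exact_neg _ m n (by ring) hmn (by omega) _ u hu)
  exact ⟨(Homotopy.ofEq (sub_add_cancel f N).symm).trans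
    ((H.add (Homotopy.nullHomotopy hom zero)).trans (Homotopy.ofEq (add_zero 0)))⟩

end Injective

/-- If `β` is dense, then finitely generated injective modules have finite projective
dimension. -/
lemma projectiveDimension_lt_top_of_essSurj_beta {A : Type u} [Ring A] [IsNoetherianRing A]
    (hβ : (beta (Proj A)).EssSurj)
    (I : Type u) [AddCommGroup I] [Module A I] [Module.Finite A I] [Module.Injective A I] :
    projectiveDimension (ModuleCat.of A I) < ⊤ := by
  let R : Resolution (A := A) I := resolution I
  obtain ⟨T, ⟨e⟩⟩ := hβ.mem_essImage ((Dst.Q (Proj A)).obj R.toKminusb)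
  have hT : IsTotallyAcyclic T.obj.as := T.property
  change (Dst.Q (Proj A)).obj (truncObj T.obj.as hT.1) ≅ _ at e
  -- `Hom(T, R) = 0` is carried along `e` to `Hom(T, brutalTrunc T) = 0`.
  have hsub := hT.subsingleton_of_iso e (by
    have key (f : (HomotopyCategory.quotient _ _).obj T.obj.as ⟶
        (HomotopyCategory.quotient _ _).obj R.complex) : f = 0 := by
      obtain ⟨g, rfl⟩ := (HomotopyCategory.quotient _ _).map_surjective f
      obtain ⟨H⟩ := R.homotopy_zero hT.1 g
      exact (HomotopyCategory.eq_of_homotopy _ _ H).trans (Functor.map_zero _ _ _)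
    exact ⟨fun f g ↦ (key f).trans (key g).symm⟩)
  have hπ : (HomotopyCategory.quotient _ _).map (toBrutalTrunc T.obj.as) =
      (HomotopyCategory.quotient _ _).map 0 := hsub.elim _ _
  obtain ⟨Z, hZ, hZ', a, b, ⟨H⟩⟩ :=
    homotopy_id_brutalTrunc (HomotopyCategory.homotopyOfEq _ _ hπ)
  have hzero : IsZero ((Dst.Q (Proj A)).obj (truncObj T.obj.as hT.1)) :=
    isZero_Q_of_factorization _ Z 0 0 hZ hZ'
      ((HomotopyCategory.quotient _ _).map a) ((HomotopyCategory.quotient _ _).map b)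
      (by simpa using! HomotopyCategory.eq_of_homotopy _ _ H)
  -- Only the lower bound `m` of `B` matters: `a ≫ b` vanishes below it.
  obtain ⟨B, m, hB, a, b, hab⟩ := exists_factorization_of_isZero_Q R.toKminusb
    (hzero.of_iso e.symm)
  change (HomotopyCategory.quotient _ _).obj R.complex ⟶ _ at a
  change _ ⟶ (HomotopyCategory.quotient _ _).obj R.complex at b
  obtain ⟨a, rfl⟩ := (HomotopyCategory.quotient _ _).map_surjective a
  obtain ⟨b, rfl⟩ := (HomotopyCategory.quotient _ _).map_surjective b
  refine R.projectiveDimension_lt_top_of_homotopy (a ≫ b) m (fun p hp ↦ ?_)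
    (HomotopyCategory.homotopyOfEq _ _ (by
      rw [Functor.map_comp]
      exact (CategoryTheory.Functor.map_id _ _).trans hab))
  rw [HomologicalComplex.comp_f,
    (CochainComplex.isZero_of_isStrictlyGE B m p hp).eq_of_tgt (a.f p) 0, zero_comp]

end StableDerived

end

theorem proposition2p6 {A : Type u} [Ring A] [IsNoetherianRing A]
    (hβ : (StableDerived.beta (StableDerived.Proj A)).EssSurj)
    (I : Type u) [AddCommGroup I] [Module A I] [Module.Finite A I] [Module.Injective A I] :
    CategoryTheory.projectiveDimension (ModuleCat.of A I) < ⊤ :=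
  StableDerived.projectiveDimension_lt_top_of_essSurj_beta hβ I
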